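/- Let $(X,\mathsf d)$ be a complete separable metric space, let $\mu_0,\mu_1$ be finite nonnegative Borel measures on $X$, let $p>0$, and put $Y:=X\times[0,\infty)$, with points $y_i=(x_i,s_i)\in Y$. Let $c\colon X\times X\to[0,\infty]$ be lower semicontinuous and let $\nu_Y$ be a Borel probability measure on $Y\times Y$. Let $F\colon[0,\infty)\to[0,\infty]$ be an entropy function, i.e. convex, lower semicontinuous and finite at some positive point (for example $F(s)=s\log s-s+1$). Put $F'_\infty:=\lim_{s\to\infty}F(s)/s$, $R(s):=sF(1/s)$ for $s>0$, and $R(0):=F'_\infty$. The induced marginal perspective cost is the function $H\colon Y\times Y\to[0,\infty]$ such that, if $c(x_0,x_1)<\infty$, then $(s_0,s_1)\mapsto H(x_0,s_0,x_1,s_1)$ is the lower semicontinuous envelope on $[0,\infty)^2$ of $$(s_0,s_1)\mapsto\inf_{t>0}\ t\Big(R\big(\tfrac{s_0}{t}\big)+R\big(\tfrac{s_1}{t}\big)+c(x_0,x_1)\Big),$$ and, if $c(x_0,x_1)=\infty$, then $H(x_0,s_0,x_1,s_1)=F(0)s_0+F(0)s_1$, with $\infty\cdot 0=0$. Put $H_p(y_0,y_1):=H(x_0,s_0^p,x_1,s_1^p)$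 and $(H_p,\alpha):=\int_{Y\times Y}H_p\,d\alpha$. For probability measures $\alpha$ on $Y\times Y$ let $\mathcal F(\alpha\mid\nu_Y)\in[0,\infty]$ be the Kullback–Leibler divergence (relative entropy) of $\alpha$ with respect to $\nu_Y$. Let $\mathsf h^p\beta:=\pi^{x}_{\#}(s^p\beta)$ for $\beta\in\mathcal P(Y)$, let $\mathsf h^p_i\alpha:=\pi^{x_i}_{\#}(s_i^p\alpha)$ for $\alpha\in\mathcal P(Y\times Y)$, $i=0,1$, put $s_*:=(\mu_0(X)+\mu_1(X))^{1/p}$ and $Y[s_*]:=\{(x,s)\in Y: s\le s_*\}$, and define $$\overline S^p_=(\mu_0,\mu_1):=\{\alpha\in\mathcal P(Y\times Y):\ \mathsf h_i^p\alpha=\mu_i\ (i=0,1),\ \alpha\big((Y\times Y)\setminus(Y[s_*]\times Y[s_*])\big)=0\},$$ $$\overline S^p_=(\mu_i):=\{\beta\in\mathcal P(Y):\ \mathsf h^p\beta=\mu_i,\ \beta(Y\setminus Y[s_*])=0\}.$$ For $\varepsilon>0$ let $$\mathrm{UOT}_{Y,\varepsilon}(\mu_0,\mu_1):=\inf_{\alpha\in\overline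 S^p_=(\mu_0,\mu_1)}\big\{(H_p,\alpha)+\varepsilon\,\mathcal F(\alpha\mid\nu_Y)\big\},\qquad \mathrm{OT}_\varepsilon(\beta_0,\beta_1):=\inf_{\alpha}\big\{(H_p,\alpha)+\varepsilon\,\mathcal F(\alpha\mid\nu_Y)\big\},$$ where the second infimum is over all $\alpha\in\mathcal P(Y\times Y)$ with marginals $\beta_0,\beta_1\in\mathcal P(Y)$. Both infima take values in $[0,\infty]$. Then for every $\varepsilon>0$ there exists $\overline\alpha^\varepsilon\in\overline S^p_=(\mu_0,\mu_1)$ such that $$\mathrm{UOT}_{Y,\varepsilon}(\mu_0,\mu_1)=(H_p,\overline\alpha^\varepsilon)+\varepsilon\,\mathcal F(\overline\alpha^\varepsilon\mid\nu_Y)=\mathrm{OT}_\varepsilon(\overline\alpha^\varepsilon_0,\overline\alpha^\varepsilon_1),$$ where $\overline\alpha^\varepsilon_i:=\pi^i_{\#}\overline\alpha^\varepsilon\in\overline S^p_=(\mu_i)$ is the $i$th marginal, $i=0,1$. -/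

import Mathlib

open MeasureTheory Filter Topology
open scoped NNReal ENNReal

noncomputable section

namespace EUOT

/-- Entropy functions: convex, lower semicontinuous functions `F : [0,∞) → [0,∞]` that are finite
at some positive point. -/
structure IsEntropyFunction (F : ℝ≥0 → ℝ≥0∞) : Prop where
  convex : ConvexOn ℝ≥0 Set.univ F
  lsc : LowerSemicontinuous F
  proper : ∃ s : ℝ≥0, 0 < s ∧ F s ≠ ∞

/-- The recession constant `F'_∞ = lim_{s → ∞} F(s)/s`; for an entropy function the limit exists
in `[0,∞]`, so it is equal to the lower limit. -/
def recession (F : ℝ≥0 → ℝ≥0∞) : ℝ≥0∞ :=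
  liminf (fun s : ℝ≥0 => F s / (s : ℝ≥0∞)) atTop

/-- The reverse entropy: `R(s) = s F(1/s)` for `s > 0` and `R(0) = F'_∞`. -/
def reverseEntropy (F : ℝ≥0 → ℝ≥0∞) (s : ℝ≥0) : ℝ≥0∞ :=
  if s = 0 then recession F else (s : ℝ≥0∞) * F s⁻¹

/-- `inf_{t > 0} t (R(s₀/t) + R(s₁/t) + c)`. -/
def perspectiveInf (F : ℝ≥0 → ℝ≥0∞) (c : ℝ≥0∞) (s₀ s₁ : ℝ≥0) : ℝ≥0∞ :=
  ⨅ (t : ℝ≥0) (_ : 0 < t),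
    (t : ℝ≥0∞) * (reverseEntropy F (s₀ / t) + reverseEntropy F (s₁ / t) + c)

/-- The marginal perspective function. For `c < ∞` it is the lower semicontinuous envelope in
`(s₀, s₁)` of `inf_{t > 0} t (R(s₀/t) + R(s₁/t) + c)`: the lower limit is along the full
neighbourhood filter, the point itself included. For `c = ∞` it is `F(0) s₀ + F(0) s₁`, with
`∞ · 0 = 0`. -/
def perspective (F : ℝ≥0 → ℝ≥0∞) (c : ℝ≥0∞) (s₀ s₁ : ℝ≥0) : ℝ≥0∞ :=
  if c = ∞ then F 0 * (s₀ : ℝ≥0∞) + F 0 * (s₁ : ℝ≥0∞)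
  else liminf (fun q : ℝ≥0 × ℝ≥0 => perspectiveInf F c q.1 q.2) (𝓝 (s₀, s₁))

variable {X : Type*}

/-- The extended space `Y = X × ℝ₊`. -/
abbrev Ext (X : Type*) : Type _ := X × ℝ≥0

/-- The induced marginal perspective cost `H(x₀,s₀,x₁,s₁)`. -/
def H (F : ℝ≥0 → ℝ≥0∞) (c : X × X → ℝ≥0∞) (x₀ : X) (s₀ : ℝ≥0) (x₁ : X) (s₁ : ℝ≥0) : ℝ≥0∞ :=
  perspective F (c (x₀, x₁)) s₀ s₁

/-- `H_p(y₀,y₁) = H(x₀,s₀^p,x₁,s₁^p)`. -/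
def Hp (F : ℝ≥0 → ℝ≥0∞) (c : X × X → ℝ≥0∞) (p : ℝ) (y : Ext X × Ext X) : ℝ≥0∞ :=
  H F c y.1.1 (y.1.2 ^ p) y.2.1 (y.2.2 ^ p)

variable [MeasurableSpace X]

/-- The homogeneous marginal `𝗁^p β = π^x_#(s^p β)` of a measure on `Y`. -/
def homMarginal (p : ℝ) (β : Measure (Ext X)) : Measure X :=
  (β.withDensity (fun y => ((y.2 ^ p : ℝ≥0) : ℝ≥0∞))).map (fun y => y.1)

/-- `𝗁₀^p α = π^{x₀}_#(s₀^p α)`. -/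
def homMarginal₀ (p : ℝ) (α : Measure (Ext X × Ext X)) : Measure X :=
  (α.withDensity (fun y => ((y.1.2 ^ p : ℝ≥0) : ℝ≥0∞))).map (fun y => y.1.1)

/-- `𝗁₁^p α = π^{x₁}_#(s₁^p α)`. -/
def homMarginal₁ (p : ℝ) (α : Measure (Ext X × Ext X)) : Measure X :=
  (α.withDensity (fun y => ((y.2.2 ^ p : ℝ≥0) : ℝ≥0∞))).map (fun y => y.2.1)

/-- `s_* = (μ₀(X) + μ₁(X))^{1/p}`. -/
def sStar (p : ℝ) (μ₀ μ₁ : Measure X) : ℝ≥0 :=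
  ((μ₀ Set.univ).toNNReal + (μ₁ Set.univ).toNNReal) ^ (1 / p)

/-- `Y[r] = {(x,s) ∈ Y : s ≤ r}`. -/
def extBall (X : Type*) (r : ℝ≥0) : Set (Ext X) := {y | y.2 ≤ r}

/-- The rescaled constraint set on `Y × Y`: probability measures with homogeneous marginals
`μ₀, μ₁` that do not charge the complement of `Y[s_*] × Y[s_*]`. -/
def constraintSet (p : ℝ) (μ₀ μ₁ : Measure X) : Set (Measure (Ext X × Ext X)) :=
  {α | IsProbabilityMeasure α ∧ homMarginal₀ p α = μ₀ ∧ homMarginal₁ p α = μ₁ ∧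
    α (extBall X (sStar p μ₀ μ₁) ×ˢ extBall X (sStar p μ₀ μ₁))ᶜ = 0}

/-- The rescaled constraint set on `Y` for one measure `μ` and radius bound `r`: probability
measures with homogeneous marginal `μ` that do not charge the complement of `Y[r]`. -/
def constraintSetOne (p : ℝ) (r : ℝ≥0) (μ : Measure X) : Set (Measure (Ext X)) :=
  {β | IsProbabilityMeasure β ∧ homMarginal p β = μ ∧ β (extBall X r)ᶜ = 0}

/-- `Γ(β₀,β₁)`: the couplings of `β₀` and `β₁`. -/
def couplings (β₀ β₁ : Measure (Ext X)) : Set (Measure (Ext X × Ext X)) :=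
  {α | IsProbabilityMeasure α ∧ α.map Prod.fst = β₀ ∧ α.map Prod.snd = β₁}

/-- The regularised functional `(H_p, α) + ε 𝓕(α | ν)`, with `𝓕` the Kullback–Leibler
divergence. -/
def energy (F : ℝ≥0 → ℝ≥0∞) (c : X × X → ℝ≥0∞) (p ε : ℝ) (ν α : Measure (Ext X × Ext X)) :
    ℝ≥0∞ :=
  (∫⁻ y, Hp F c p y ∂α) + ENNReal.ofReal ε * InformationTheory.klDiv α ν

/-- The extended-space regularised problem `UOT_{Y,ε}(μ₀,μ₁)`. -/
def UOTY (F : ℝ≥0 → ℝ≥0∞) (c : X × X → ℝ≥0∞) (p ε : ℝ) (ν : Measure (Ext X × Ext X))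
    (μ₀ μ₁ : Measure X) : ℝ≥0∞ :=
  ⨅ α ∈ constraintSet p μ₀ μ₁, energy F c p ε ν α

/-- The regularised optimal transport problem `OT_ε(β₀,β₁)` on `Y`. -/
def OTeps (F : ℝ≥0 → ℝ≥0∞) (c : X × X → ℝ≥0∞) (p ε : ℝ) (ν : Measure (Ext X × Ext X))
    (β₀ β₁ : Measure (Ext X)) : ℝ≥0∞ :=
  ⨅ α ∈ couplings β₀ β₁, energy F c p ε ν α

end EUOT

end

/-!
By strict convexity of `t ↦ t log t`, the midpoint of two measures has a Kullback–Leibler divergence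
smaller than the average by at least a quarter of the squared Hellinger distance of their
densities, and by Cauchy–Schwarz this distance controls the `L¹(ν)`-distance. The cost term is
affine, so along a minimising sequence in a constraint set stable under midpoints the densities are
Cauchy in `L¹(ν)`. Fatou's lemma gives lower semicontinuity of the functional along the sequence,
for an arbitrary cost. The limit is admissible because on `Y[s_*]` the weight `s ^ p` is bounded, so
homogeneous marginals pass to limits of measures whose densities converge in `L¹(ν)`. Finally,
membership in the constraint set only depends on the two marginals, so every coupling of the
marginals of a minimiser is an admissible competitor.
-/

namespace EUOT

open InformationTheory

section KLFun

lemma sq_sqrt_sub_sqrt_le_mul_log {a m : ℝ} (ha : 0 ≤ a) (hm : 0 < m) :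
    (√a - √m) ^ 2 ≤ a * Real.log a - a * Real.log m - a + m := by
  rcases ha.eq_or_lt with rfl | ha
  · simp [Real.sq_sqrt hm.le]
  have hlog : Real.log m / 2 - Real.log a / 2 ≤ √m / √a - 1 := by
    rw [← Real.log_sqrt hm.le, ← Real.log_sqrt ha.le,
      ← Real.log_div (Real.sqrt_pos.2 hm).ne' (Real.sqrt_pos.2 ha).ne']
    exact Real.log_le_sub_one_of_pos (div_pos (Real.sqrt_pos.2 hm) (Real.sqrt_pos.2 ha))
  have hcross : a * (√m / √a) = √a * √m := by
    rw [mul_div_left_comm, Real.div_sqrt, mul_comm]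
  nlinarith [mul_le_mul_of_nonneg_left hlog ha.le, Real.sq_sqrt ha.le, Real.sq_sqrt hm.le]

lemma two_mul_klFun_midpoint_add_le {a b : ℝ} (ha : 0 ≤ a) (hb : 0 ≤ b) :
    2 * klFun ((a + b) / 2) + (√a - √b) ^ 2 / 2 ≤ klFun a + klFun b := by
  rcases (add_nonneg ha hb).eq_or_lt with h0 | h0
  · obtain rfl : a = 0 := by linarith
    obtain rfl : b = 0 := by linarith
    simp [two_mul]
  set m := (a + b) / 2 with hm
  have hab : a + b = 2 * m := by rw [hm]; ring
  have hma := sq_sqrt_sub_sqrt_le_mul_log (m := m) ha (by linarith)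
  have hmb := sq_sqrt_sub_sqrt_le_mul_log (m := m) hb (by linarith)
  have hparallelogram : (√a - √b) ^ 2 / 2 ≤ (√a - √m) ^ 2 + (√b - √m) ^ 2 := by
    nlinarith [sq_nonneg (√a + √b - 2 * √m)]
  have hlog : a * Real.log m + b * Real.log m = 2 * (m * Real.log m) := by
    rw [← add_mul, hab, mul_assoc]
  simp only [klFun_apply]
  linarith

end KLFun

section Density

variable {Ω : Type*} [MeasurableSpace Ω] {ν α β : Measure Ω}

/-- The Radon–Nikodym density of `α` with respect to `ν`. It is taken with real values so that
densities can be subtracted and the completeness of `L¹(ν)` applies to them. -/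
noncomputable def density (α ν : Measure Ω) (x : Ω) : ℝ := (α.rnDeriv ν x).toReal

lemma density_nonneg (α ν : Measure Ω) (x : Ω) : 0 ≤ density α ν x := ENNReal.toReal_nonneg

@[fun_prop]
lemma measurable_density (α ν : Measure Ω) : Measurable (density α ν) :=
  (Measure.measurable_rnDeriv α ν).ennreal_toReal

lemma ofReal_density_ae_eq (α ν : Measure Ω) [SigmaFinite α] :
    (fun x => ENNReal.ofReal (density α ν x)) =ᵐ[ν] α.rnDeriv ν :=
  (Measure.rnDeriv_ne_top α ν).mono fun _ hx => ENNReal.ofReal_toReal hx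

lemma lintegral_ofReal_density_le (α ν : Measure Ω) [SigmaFinite α] :
    ∫⁻ x, ENNReal.ofReal (density α ν x) ∂ν ≤ α Set.univ := by
  rw [lintegral_congr_ae (ofReal_density_ae_eq α ν)]
  exact Measure.lintegral_rnDeriv_le

lemma lintegral_density_mul [SigmaFinite α] [SigmaFinite ν] (hα : α ≪ ν) {φ : Ω → ℝ≥0∞}
    (hφ : Measurable φ) :
    ∫⁻ x, ENNReal.ofReal (density α ν x) * φ x ∂ν = ∫⁻ x, φ x ∂α := by
  rw [← lintegral_rnDeriv_mul hα hφ.aemeasurable]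
  refine lintegral_congr_ae ?_
  filter_upwards [ofReal_density_ae_eq α ν] with x hx
  rw [hx]

lemma density_midpoint_ae_eq [IsFiniteMeasure α] [IsFiniteMeasure β] [SigmaFinite ν] :
    density ((2⁻¹ : ℝ≥0) • (α + β)) ν =ᵐ[ν] fun x => (density α ν x + density β ν x) / 2 := by
  filter_upwards [Measure.rnDeriv_smul_left (α + β) ν 2⁻¹, Measure.rnDeriv_add α β ν,
    Measure.rnDeriv_ne_top α ν, Measure.rnDeriv_ne_top β ν] with x hsmul hadd hα hβ
  rw [density, hsmul, Pi.smul_apply, hadd, Pi.add_apply, ENNReal.toReal_smul,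
    ENNReal.toReal_add hα hβ, NNReal.smul_def, smul_eq_mul, NNReal.coe_inv, NNReal.coe_ofNat,
    inv_mul_eq_div]
  rfl

lemma density_withDensity_ae_eq [SigmaFinite ν] {g : Ω → ℝ} (hg : AEMeasurable g ν) :
    density (ν.withDensity fun x => ENNReal.ofReal (g x)) ν =ᵐ[ν] fun x => max (g x) 0 := by
  filter_upwards [Measure.rnDeriv_withDensity₀ ν hg.ennreal_ofReal] with x hx
  rw [density, hx, ENNReal.toReal_ofReal']

/-- The squared Hellinger distance `∫ (√a - √b)² dν` between the densities `a`, `b` of `α` and `β`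
with respect to `ν`, which measures how strictly convex the Kullback–Leibler divergence is. -/
noncomputable def hellingerSq (α β ν : Measure Ω) : ℝ≥0∞ :=
  ∫⁻ x, ENNReal.ofReal ((√(density α ν x) - √(density β ν x)) ^ 2) ∂ν

lemma lintegral_sq_enorm_sqrt_density_add_le (α β ν : Measure Ω) [SigmaFinite α] [SigmaFinite β] :
    ∫⁻ x, ‖√(density α ν x) + √(density β ν x)‖ₑ ^ 2 ∂ν ≤ 2 * (α Set.univ + β Set.univ) := by
  calc ∫⁻ x, ‖√(density α ν x) + √(density β ν x)‖ₑ ^ 2 ∂ν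
      ≤ ∫⁻ x, 2 * (ENNReal.ofReal (density α ν x) + ENNReal.ofReal (density β ν x)) ∂ν := by
        refine lintegral_mono fun x => ?_
        rw [← ENNReal.ofReal_add (density_nonneg α ν x) (density_nonneg β ν x),
          ← ENNReal.ofReal_ofNat 2, ← ENNReal.ofReal_mul zero_le_two, Real.enorm_eq_ofReal_abs,
          ← ENNReal.ofReal_pow (abs_nonneg _), sq_abs]
        refine ENNReal.ofReal_le_ofReal (add_sq_le.trans_eq ?_)
        rw [Real.sq_sqrt (density_nonneg α ν x), Real.sq_sqrt (density_nonneg β ν x)]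
    _ ≤ 2 * (α Set.univ + β Set.univ) := by
        rw [lintegral_const_mul _ (by fun_prop), lintegral_add_left (by fun_prop)]
        gcongr <;> exact lintegral_ofReal_density_le _ ν

lemma sq_eLpNorm_density_sub_le (α β ν : Measure Ω) [SigmaFinite α] [SigmaFinite β] :
    eLpNorm (density α ν - density β ν) 1 ν ^ 2
      ≤ hellingerSq α β ν * (2 * (α Set.univ + β Set.univ)) := by
  set u : Ω → ℝ := fun x => √(density α ν x)
  set v : Ω → ℝ := fun x => √(density β ν x)
  have hfactor (x : Ω) : density α ν x - density β ν x = (u x - v x) * (u x + v x) := by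
    rw [mul_comm, ← sq_sub_sq, Real.sq_sqrt (density_nonneg α ν x),
      Real.sq_sqrt (density_nonneg β ν x)]
  have hminus : ∫⁻ x, ‖u x - v x‖ₑ ^ 2 ∂ν = hellingerSq α β ν := by
    refine lintegral_congr fun x => ?_
    rw [Real.enorm_eq_ofReal_abs, ← ENNReal.ofReal_pow (abs_nonneg _), sq_abs]
  have hCauchySchwarz := ENNReal.lintegral_mul_le_Lp_mul_Lq ν Real.HolderConjugate.two_two
    (f := fun x => ‖u x - v x‖ₑ) (g := fun x => ‖u x + v x‖ₑ) (by fun_prop) (by fun_prop)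
  simp only [Pi.mul_apply, ENNReal.rpow_ofNat, ← enorm_mul, ← hfactor, hminus] at hCauchySchwarz
  calc eLpNorm (density α ν - density β ν) 1 ν ^ 2
      ≤ (hellingerSq α β ν ^ (1 / 2 : ℝ) * (∫⁻ x, ‖u x + v x‖ₑ ^ 2 ∂ν) ^ (1 / 2 : ℝ)) ^ 2 := by
        rw [eLpNorm_one_eq_lintegral_enorm]
        exact pow_le_pow_left' hCauchySchwarz 2
    _ = hellingerSq α β ν * ∫⁻ x, ‖u x + v x‖ₑ ^ 2 ∂ν := by
        rw [mul_pow, ← ENNReal.rpow_mul_natCast, ← ENNReal.rpow_mul_natCast]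
        norm_num
    _ ≤ hellingerSq α β ν * (2 * (α Set.univ + β Set.univ)) := by
        gcongr
        exact lintegral_sq_enorm_sqrt_density_add_le α β ν

end Density

section EntropicEnergy

variable {Ω : Type*} [MeasurableSpace Ω] {ν : Measure Ω}

/-- The functional `α ↦ ∫ G dα + ε KL(α | ν)`, the common form of the objectives of all the
regularised problems. For a non-measurable cost `G` the first term is the lower integral. -/
noncomputable def entropicEnergy (G : Ω → ℝ≥0∞) (ε : ℝ≥0) (ν α : Measure Ω) : ℝ≥0∞ :=
  (∫⁻ x, G x ∂α) + ε * klDiv α ν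

lemma absolutelyContinuous_of_entropicEnergy_ne_top {G : Ω → ℝ≥0∞} {ε : ℝ≥0} (hε : 0 < ε)
    {α : Measure Ω} (h : entropicEnergy G ε ν α ≠ ∞) : α ≪ ν := by
  by_contra hα
  rw [entropicEnergy, klDiv_of_not_ac hα, ENNReal.mul_top (by simpa using hε.ne'), add_top] at h
  exact h rfl

variable [IsFiniteMeasure ν]

lemma two_mul_klDiv_midpoint_add_hellingerSq_le (α β : Measure Ω) [IsFiniteMeasure α]
    [IsFiniteMeasure β] :
    2 * klDiv ((2⁻¹ : ℝ≥0) • (α + β)) ν + 2⁻¹ * hellingerSq α β ν ≤ klDiv α ν + klDiv β ν := by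
  by_cases hα : α ≪ ν
  swap
  · simp [klDiv_of_not_ac hα]
  by_cases hβ : β ≪ ν
  swap
  · simp [klDiv_of_not_ac hβ]
  rw [klDiv_eq_lintegral_klFun_of_ac ((hα.add_left hβ).smul_left _),
    klDiv_eq_lintegral_klFun_of_ac hα, klDiv_eq_lintegral_klFun_of_ac hβ, hellingerSq,
    ← lintegral_const_mul _ (by fun_prop), ← lintegral_const_mul _ (by fun_prop),
    ← lintegral_add_left (by fun_prop), ← lintegral_add_left (by fun_prop)]
  refine lintegral_mono_ae ?_
  filter_upwards [density_midpoint_ae_eq (α := α) (β := β) (ν := ν)] with x hmid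
  have ha := density_nonneg α ν x
  have hb := density_nonneg β ν x
  change 2 * ENNReal.ofReal (klFun (density ((2⁻¹ : ℝ≥0) • (α + β)) ν x)) + _
    ≤ ENNReal.ofReal (klFun (density α ν x)) + ENNReal.ofReal (klFun (density β ν x))
  have hhalf : (2⁻¹ : ℝ≥0∞) = ENNReal.ofReal 2⁻¹ := by
    rw [ENNReal.ofReal_inv_of_pos two_pos, ENNReal.ofReal_ofNat]
  rw [hmid, hhalf, ← ENNReal.ofReal_ofNat 2, ← ENNReal.ofReal_mul zero_le_two,
    ← ENNReal.ofReal_mul (by positivity), ← ENNReal.ofReal_add (klFun_nonneg ha) (klFun_nonneg hb),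
    ← ENNReal.ofReal_add (mul_nonneg zero_le_two (klFun_nonneg (by positivity))) (by positivity),
    ← div_eq_inv_mul]
  exact ENNReal.ofReal_le_ofReal (two_mul_klFun_midpoint_add_le ha hb)

lemma two_mul_klDiv_midpoint_add_sq_eLpNorm_le (α β : Measure Ω) [IsProbabilityMeasure α]
    [IsProbabilityMeasure β] :
    2 * klDiv ((2⁻¹ : ℝ≥0) • (α + β)) ν + eLpNorm (density α ν - density β ν) 1 ν ^ 2 / 8
      ≤ klDiv α ν + klDiv β ν := by
  refine le_trans ?_ (two_mul_klDiv_midpoint_add_hellingerSq_le α β)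
  gcongr
  refine ENNReal.div_le_of_le_mul ?_
  calc eLpNorm (density α ν - density β ν) 1 ν ^ 2
      ≤ hellingerSq α β ν * (2 * (α Set.univ + β Set.univ)) := sq_eLpNorm_density_sub_le α β ν
    _ = hellingerSq α β ν * (2⁻¹ * 2 * 4) := by
        rw [measure_univ, measure_univ, ENNReal.inv_mul_cancel two_ne_zero ENNReal.ofNat_ne_top]
        norm_num
    _ = 2⁻¹ * hellingerSq α β ν * 8 := by ring

lemma two_mul_entropicEnergy_midpoint_add_le (G : Ω → ℝ≥0∞) (ε : ℝ≥0) (α β : Measure Ω)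
    [IsProbabilityMeasure α] [IsProbabilityMeasure β] :
    2 * entropicEnergy G ε ν ((2⁻¹ : ℝ≥0) • (α + β))
        + ε * (eLpNorm (density α ν - density β ν) 1 ν ^ 2 / 8)
      ≤ entropicEnergy G ε ν α + entropicEnergy G ε ν β := by
  have hcost : 2 * ∫⁻ x, G x ∂((2⁻¹ : ℝ≥0) • (α + β)) = ∫⁻ x, G x ∂α + ∫⁻ x, G x ∂β := by
    rw [lintegral_smul_measure, lintegral_add_measure, ENNReal.smul_def, smul_eq_mul, ← mul_assoc,
      ENNReal.coe_inv two_ne_zero, ENNReal.coe_ofNat,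
      ENNReal.mul_inv_cancel two_ne_zero ENNReal.ofNat_ne_top, one_mul]
  calc _ = (∫⁻ x, G x ∂α + ∫⁻ x, G x ∂β) + ε * (2 * klDiv ((2⁻¹ : ℝ≥0) • (α + β)) ν
        + eLpNorm (density α ν - density β ν) 1 ν ^ 2 / 8) := by
        rw [← hcost, entropicEnergy]
        ring
    _ ≤ (∫⁻ x, G x ∂α + ∫⁻ x, G x ∂β) + ε * (klDiv α ν + klDiv β ν) := by
        gcongr _ + _ * ?_
        exact two_mul_klDiv_midpoint_add_sq_eLpNorm_le α β
    _ = _ := by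
        simp only [entropicEnergy]
        ring

lemma sq_eLpNorm_density_sub_le_of_entropicEnergy_le {G : Ω → ℝ≥0∞} {ε : ℝ≥0} (hε : 0 < ε)
    {α β : Measure Ω} [IsProbabilityMeasure α] [IsProbabilityMeasure β] {I δ : ℝ≥0∞} (hI : I ≠ ∞)
    (hmid : I ≤ entropicEnergy G ε ν ((2⁻¹ : ℝ≥0) • (α + β)))
    (hα : entropicEnergy G ε ν α ≤ I + ε * δ) (hβ : entropicEnergy G ε ν β ≤ I + ε * δ) :
    eLpNorm (density α ν - density β ν) 1 ν ^ 2 ≤ 16 * δ := by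
  set D := eLpNorm (density α ν - density β ν) 1 ν
  have hgap : 2 * I + ε * (D ^ 2 / 8) ≤ 2 * I + ε * (2 * δ) := by
    calc 2 * I + ε * (D ^ 2 / 8)
        ≤ 2 * entropicEnergy G ε ν ((2⁻¹ : ℝ≥0) • (α + β)) + ε * (D ^ 2 / 8) := by gcongr
      _ ≤ entropicEnergy G ε ν α + entropicEnergy G ε ν β :=
        two_mul_entropicEnergy_midpoint_add_le G ε α β
      _ ≤ (I + ε * δ) + (I + ε * δ) := add_le_add hα hβ
      _ = 2 * I + ε * (2 * δ) := by ring
  have hD : D ^ 2 / 8 ≤ 2 * δ :=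
    (ENNReal.mul_le_mul_iff_right (by simpa using hε.ne') ENNReal.coe_ne_top).1
      ((ENNReal.add_le_add_iff_left (ENNReal.mul_ne_top ENNReal.ofNat_ne_top hI)).1 hgap)
  calc D ^ 2 ≤ 2 * δ * 8 := (ENNReal.div_le_iff (by norm_num) (by norm_num)).1 hD
    _ = 16 * δ := by ring

lemma entropicEnergy_eq_lintegral_density {G : Ω → ℝ≥0∞} (hG : Measurable G) (ε : ℝ≥0)
    {α : Measure Ω} [IsFiniteMeasure α] (hα : α ≪ ν) :
    entropicEnergy G ε ν α = ∫⁻ x, (ENNReal.ofReal (density α ν x) * G x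
      + ε * ENNReal.ofReal (klFun (density α ν x))) ∂ν := by
  rw [lintegral_add_left (by fun_prop), lintegral_const_mul _ (by fun_prop),
    lintegral_density_mul hα hG, entropicEnergy, klDiv_eq_lintegral_klFun_of_ac hα]
  rfl

lemma ofReal_mul_add_klFun_le_liminf {ι : Type*} {l : Filter ι} [l.NeBot] (G : ℝ≥0∞) (ε : ℝ≥0)
    {a : ι → ℝ} {b : ℝ} (h : Tendsto a l (𝓝 b)) :
    ENNReal.ofReal b * G + ε * ENNReal.ofReal (klFun b)
      ≤ liminf (fun i => ENNReal.ofReal (a i) * G + ε * ENNReal.ofReal (klFun (a i))) l := by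
  have hkl : Tendsto (fun i => (ε : ℝ≥0∞) * ENNReal.ofReal (klFun (a i))) l
      (𝓝 (ε * ENNReal.ofReal (klFun b))) :=
    ENNReal.Tendsto.const_mul (ENNReal.tendsto_ofReal ((continuous_klFun.tendsto b).comp h))
      (Or.inr ENNReal.coe_ne_top)
  rcases eq_or_ne (ENNReal.ofReal b) 0 with hb | hb
  · -- `G` may be infinite, in which case `ofReal (a i) * G` need not tend to `0 * G`.
    rw [hb, zero_mul, zero_add, ← hkl.liminf_eq]
    exact liminf_le_liminf (Eventually.of_forall fun i => le_add_self)
  · have hcost := ENNReal.Tendsto.mul_const (ENNReal.tendsto_ofReal h) (b := G) (Or.inl hb)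
    exact (hcost.add hkl).liminf_eq.ge

lemma entropicEnergy_le_liminf (G : Ω → ℝ≥0∞) (ε : ℝ≥0) {α : ℕ → Measure Ω} {β : Measure Ω}
    [∀ n, IsFiniteMeasure (α n)] [IsFiniteMeasure β] (hα : ∀ n, α n ≪ ν) (hβ : β ≪ ν)
    (h : ∀ᵐ x ∂ν, Tendsto (fun n => density (α n) ν x) atTop (𝓝 (density β ν x))) :
    entropicEnergy G ε ν β ≤ liminf (fun n => entropicEnergy G ε ν (α n)) atTop := by
  obtain ⟨G', hG'meas, hG'le, hG'⟩ := exists_measurable_le_lintegral_eq (μ := β) G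
  calc entropicEnergy G ε ν β = entropicEnergy G' ε ν β := by
        rw [entropicEnergy, hG', ← entropicEnergy]
    _ = ∫⁻ x, (ENNReal.ofReal (density β ν x) * G' x
          + ε * ENNReal.ofReal (klFun (density β ν x))) ∂ν :=
        entropicEnergy_eq_lintegral_density hG'meas ε hβ
    _ ≤ ∫⁻ x, liminf (fun n => ENNReal.ofReal (density (α n) ν x) * G' x
          + ε * ENNReal.ofReal (klFun (density (α n) ν x))) atTop ∂ν :=
        lintegral_mono_ae (h.mono fun x hx => ofReal_mul_add_klFun_le_liminf (G' x) ε hx)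
    _ ≤ liminf (fun n => ∫⁻ x, (ENNReal.ofReal (density (α n) ν x) * G' x
          + ε * ENNReal.ofReal (klFun (density (α n) ν x))) ∂ν) atTop :=
        lintegral_liminf_le fun n => by fun_prop
    _ ≤ liminf (fun n => entropicEnergy G ε ν (α n)) atTop := by
        refine liminf_le_liminf (Eventually.of_forall fun n => ?_)
        rw [← entropicEnergy_eq_lintegral_density hG'meas ε (hα n), entropicEnergy, entropicEnergy]
        gcongr
        exact hG'le _

lemma entropicEnergy_le_of_tendsto_eLpNorm (G : Ω → ℝ≥0∞) (ε : ℝ≥0) {α : ℕ → Measure Ω}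
    {β : Measure Ω} [∀ n, IsFiniteMeasure (α n)] [IsFiniteMeasure β] (hα : ∀ n, α n ≪ ν)
    (hβ : β ≪ ν) (h : Tendsto (fun n => eLpNorm (density (α n) ν - density β ν) 1 ν) atTop (𝓝 0))
    {I : ℝ≥0∞} (hI : Tendsto (fun n => entropicEnergy G ε ν (α n)) atTop (𝓝 I)) :
    entropicEnergy G ε ν β ≤ I := by
  obtain ⟨k, hk, hae⟩ := (tendstoInMeasure_of_tendsto_eLpNorm one_ne_zero
    (fun n => (measurable_density (α n) ν).aestronglyMeasurable)
    (measurable_density β ν).aestronglyMeasurable h).exists_seq_tendsto_ae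
  exact (entropicEnergy_le_liminf G ε (fun n => hα (k n)) hβ hae).trans_eq
    (hI.comp hk.tendsto_atTop).liminf_eq

end EntropicEnergy

section TendstoSetwise

variable {Ω Ω' ι : Type*} [MeasurableSpace Ω] [MeasurableSpace Ω'] {l : Filter ι}
  {α : ι → Measure Ω} {β : Measure Ω}

/-- Setwise convergence of measures, expressed through the integrals of all bounded measurable
functions rather than through the masses of measurable sets. -/
def TendstoSetwise (α : ι → Measure Ω) (l : Filter ι) (β : Measure Ω) : Prop :=
  ∀ φ : Ω → ℝ≥0∞, Measurable φ → (∃ M : ℝ≥0, ∀ x, φ x ≤ M) →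
    Tendsto (fun i => ∫⁻ x, φ x ∂(α i)) l (𝓝 (∫⁻ x, φ x ∂β))

lemma TendstoSetwise.apply (h : TendstoSetwise α l β) {A : Set Ω} (hA : MeasurableSet A) :
    Tendsto (fun i => α i A) l (𝓝 (β A)) := by
  simpa only [lintegral_indicator_one hA] using
    h (A.indicator 1) (measurable_one.indicator hA) ⟨1, Set.indicator_le_self' (by simp)⟩

lemma TendstoSetwise.map (h : TendstoSetwise α l β) {f : Ω → Ω'} (hf : Measurable f) :
    TendstoSetwise (fun i => (α i).map f) l (β.map f) := by
  rintro φ hφ ⟨M, hM⟩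
  simpa only [lintegral_map hφ hf] using h (fun x => φ (f x)) (hφ.comp hf) ⟨M, fun x => hM (f x)⟩

variable {ν : Measure Ω} [SigmaFinite ν]

lemma lintegral_le_lintegral_add_eLpNorm_density_sub {α β : Measure Ω} [SigmaFinite α]
    [SigmaFinite β] (hα : α ≪ ν) (hβ : β ≪ ν) {φ : Ω → ℝ≥0∞} (hφ : Measurable φ) {M : ℝ≥0}
    (hM : ∀ x, φ x ≤ M) :
    ∫⁻ x, φ x ∂α ≤ ∫⁻ x, φ x ∂β + M * eLpNorm (density α ν - density β ν) 1 ν := by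
  have hdensity (x : Ω) : ENNReal.ofReal (density α ν x)
      ≤ ENNReal.ofReal (density β ν x) + ‖density α ν x - density β ν x‖ₑ := by
    rw [Real.enorm_eq_ofReal_abs]
    refine (ENNReal.ofReal_le_ofReal ?_).trans ENNReal.ofReal_add_le
    linarith [le_abs_self (density α ν x - density β ν x)]
  calc ∫⁻ x, φ x ∂α = ∫⁻ x, ENNReal.ofReal (density α ν x) * φ x ∂ν :=
        (lintegral_density_mul hα hφ).symm
    _ ≤ ∫⁻ x, (ENNReal.ofReal (density β ν x) * φ x
          + M * ‖density α ν x - density β ν x‖ₑ) ∂ν := by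
        refine lintegral_mono fun x => (mul_le_mul_left (hdensity x) (φ x)).trans ?_
        rw [add_mul, mul_comm ‖_‖ₑ]
        gcongr
        exact hM x
    _ = ∫⁻ x, φ x ∂β + M * eLpNorm (density α ν - density β ν) 1 ν := by
        rw [lintegral_add_left (by fun_prop), lintegral_const_mul _ (by fun_prop),
          lintegral_density_mul hβ hφ, eLpNorm_one_eq_lintegral_enorm]
        rfl

lemma tendstoSetwise_of_tendsto_eLpNorm [∀ i, SigmaFinite (α i)] [IsFiniteMeasure β]
    (hα : ∀ i, α i ≪ ν) (hβ : β ≪ ν)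
    (h : Tendsto (fun i => eLpNorm (density (α i) ν - density β ν) 1 ν) l (𝓝 0)) :
    TendstoSetwise α l β := by
  rintro φ hφ ⟨M, hM⟩
  have herror : Tendsto (fun i => M * eLpNorm (density (α i) ν - density β ν) 1 ν) l (𝓝 0) := by
    simpa using ENNReal.Tendsto.const_mul h (Or.inr (ENNReal.coe_ne_top (r := M)))
  have hfin : ∫⁻ x, φ x ∂β ≠ ∞ := by
    refine ((lintegral_mono hM).trans_lt ?_).ne
    simpa using ENNReal.mul_lt_top ENNReal.coe_lt_top (measure_lt_top β Set.univ)
  have hlower : Tendsto (fun i => ∫⁻ x, φ x ∂β - M * eLpNorm (density (α i) ν - density β ν) 1 ν)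
      l (𝓝 (∫⁻ x, φ x ∂β)) := by
    simpa using ENNReal.Tendsto.sub tendsto_const_nhds herror (Or.inl hfin)
  have hupper : Tendsto (fun i => ∫⁻ x, φ x ∂β + M * eLpNorm (density (α i) ν - density β ν) 1 ν)
      l (𝓝 (∫⁻ x, φ x ∂β)) := by
    simpa using herror.const_add (∫⁻ x, φ x ∂β)
  refine tendsto_of_tendsto_of_tendsto_of_le_of_le hlower hupper (fun i => ?_) fun i =>
    lintegral_le_lintegral_add_eLpNorm_density_sub (hα i) hβ hφ hM
  refine tsub_le_iff_right.2 ?_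
  rw [eLpNorm_sub_comm]
  exact lintegral_le_lintegral_add_eLpNorm_density_sub hβ (hα i) hφ hM

end TendstoSetwise

section Existence

variable {Ω : Type*} [MeasurableSpace Ω] {ν : Measure Ω}

lemma exists_tendsto_eLpNorm_density_sub [SigmaFinite ν] {α : ℕ → Measure Ω}
    [∀ n, IsFiniteMeasure (α n)] {b : ℕ → ℝ≥0∞} (hb : ∑' n, b n ≠ ∞)
    (hcauchy : ∀ N n m : ℕ, N ≤ n → N ≤ m →
      eLpNorm (density (α n) ν - density (α m) ν) 1 ν < b N) :
    ∃ β : Measure Ω, IsFiniteMeasure β ∧ β ≪ ν ∧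
      Tendsto (fun n => eLpNorm (density (α n) ν - density β ν) 1 ν) atTop (𝓝 0) := by
  obtain ⟨g, hg, hlim⟩ := Lp.cauchy_complete_eLpNorm le_rfl
    (fun n => memLp_one_iff_integrable.2 Measure.integrable_toReal_rnDeriv) hb hcauchy
  refine ⟨ν.withDensity fun x => ENNReal.ofReal (g x),
    isFiniteMeasure_withDensity_ofReal (memLp_one_iff_integrable.1 hg).2,
    withDensity_absolutelyContinuous _ _,
    tendsto_of_tendsto_of_tendsto_of_le_of_le tendsto_const_nhds hlim (fun _ => zero_le)
      fun n => eLpNorm_mono_ae ?_⟩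
  -- The density of the limit is the positive part of `g`, which is closer to `density (α n) ν ≥ 0`.
  filter_upwards [density_withDensity_ae_eq hg.1.aemeasurable] with x hx
  rw [Pi.sub_apply, Pi.sub_apply, hx, Real.norm_eq_abs, Real.norm_eq_abs]
  calc |density (α n) ν x - max (g x) 0|
      = |max (density (α n) ν x) 0 - max (g x) 0| := by rw [max_eq_left (density_nonneg _ _ x)]
    _ ≤ |density (α n) ν x - g x| := abs_max_sub_max_le_abs _ _ _

lemma exists_tendsto_eLpNorm_of_entropicEnergy_lt [IsFiniteMeasure ν] {G : Ω → ℝ≥0∞} {ε : ℝ≥0}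
    (hε : 0 < ε) {I : ℝ≥0∞} (hI : I ≠ ∞) {α : ℕ → Measure Ω} [∀ n, IsProbabilityMeasure (α n)]
    (hmid : ∀ n m, I ≤ entropicEnergy G ε ν ((2⁻¹ : ℝ≥0) • (α n + α m)))
    (hα : ∀ n, entropicEnergy G ε ν (α n) < I + ε * (2⁻¹ ^ n) ^ 2) :
    ∃ β : Measure Ω, IsFiniteMeasure β ∧ β ≪ ν ∧
      Tendsto (fun n => eLpNorm (density (α n) ν - density β ν) 1 ν) atTop (𝓝 0) := by
  have hsum : ∑' n : ℕ, 5 * (2⁻¹ : ℝ≥0∞) ^ n ≠ ∞ := by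
    rw [ENNReal.tsum_mul_left, ENNReal.tsum_geometric, ENNReal.one_sub_inv_two, inv_inv]
    finiteness
  refine exists_tendsto_eLpNorm_density_sub hsum fun N n m hn hm => ?_
  have henergy (k : ℕ) (hk : N ≤ k) : entropicEnergy G ε ν (α k) ≤ I + ε * (2⁻¹ ^ N) ^ 2 := by
    refine (hα k).le.trans ?_
    gcongr I + _ * ?_ ^ 2
    exact pow_le_pow_right_of_le_one' (ENNReal.inv_le_one.2 one_le_two) hk
  refine lt_of_pow_lt_pow_left' 2 ?_
  calc eLpNorm (density (α n) ν - density (α m) ν) 1 ν ^ 2 ≤ 16 * (2⁻¹ ^ N) ^ 2 :=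
        sq_eLpNorm_density_sub_le_of_entropicEnergy_le hε hI (hmid n m) (henergy n hn)
          (henergy m hm)
    _ < 25 * (2⁻¹ ^ N) ^ 2 :=
        ENNReal.mul_lt_mul_left (by simp) (by finiteness) (by norm_num)
    _ = (5 * 2⁻¹ ^ N) ^ 2 := by rw [mul_pow]; norm_num

theorem exists_isMinOn_entropicEnergy [IsFiniteMeasure ν] (G : Ω → ℝ≥0∞) {ε : ℝ≥0} (hε : 0 < ε)
    {S : Set (Measure Ω)} (hne : S.Nonempty) (hprob : ∀ α ∈ S, IsProbabilityMeasure α)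
    (hmid : ∀ α ∈ S, ∀ β ∈ S, (2⁻¹ : ℝ≥0) • (α + β) ∈ S)
    (hclosed : ∀ (α : ℕ → Measure Ω) (β : Measure Ω), (∀ n, α n ∈ S) →
      TendstoSetwise α atTop β → β ∈ S) :
    ∃ α ∈ S, IsMinOn (entropicEnergy G ε ν) S α := by
  set I := ⨅ α ∈ S, entropicEnergy G ε ν α
  have hIle (β : Measure Ω) (hβ : β ∈ S) : I ≤ entropicEnergy G ε ν β := iInf₂_le β hβ
  suffices h : ∃ α ∈ S, entropicEnergy G ε ν α ≤ I by
    obtain ⟨α, hα, h⟩ := h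
    exact ⟨α, hα, fun β hβ => h.trans (hIle β hβ)⟩
  by_cases hItop : I = ∞
  · obtain ⟨α, hα⟩ := hne
    exact ⟨α, hα, hItop ▸ le_top⟩
  have hminimising (n : ℕ) : ∃ α ∈ S, entropicEnergy G ε ν α < I + ε * (2⁻¹ ^ n) ^ 2 := by
    obtain ⟨α, h⟩ := iInf_lt_iff.1 (ENNReal.lt_add_right hItop
      (b := ε * (2⁻¹ ^ n) ^ 2) (by simp [hε.ne']))
    obtain ⟨hα, h⟩ := iInf_lt_iff.1 h
    exact ⟨α, hα, h⟩
  choose α hαS hα using hminimising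
  have (n : ℕ) : IsProbabilityMeasure (α n) := hprob _ (hαS n)
  obtain ⟨β, hβfin, hβν, hlim⟩ := exists_tendsto_eLpNorm_of_entropicEnergy_lt hε hItop
    (fun n m => hIle _ (hmid _ (hαS n) _ (hαS m))) hα
  have hαν (n : ℕ) : α n ≪ ν := absolutelyContinuous_of_entropicEnergy_ne_top hε (hα n).ne_top
  have hbound : Tendsto (fun n : ℕ => I + ε * ((2⁻¹ : ℝ≥0∞) ^ n) ^ 2) atTop (𝓝 I) := by
    have hpow := ENNReal.tendsto_pow_atTop_nhds_zero_of_lt_one ENNReal.one_half_lt_one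
    simpa using (ENNReal.Tendsto.const_mul (ENNReal.Tendsto.pow hpow (n := 2))
      (Or.inr (ENNReal.coe_ne_top (r := ε)))).const_add I
  have henergy : Tendsto (fun n => entropicEnergy G ε ν (α n)) atTop (𝓝 I) :=
    tendsto_of_tendsto_of_tendsto_of_le_of_le tendsto_const_nhds hbound
      (fun n => hIle _ (hαS n)) fun n => (hα n).le
  exact ⟨β, hclosed α β hαS (tendstoSetwise_of_tendsto_eLpNorm hαν hβν hlim),
    entropicEnergy_le_of_tendsto_eLpNorm G ε hαν hβν hlim henergy⟩

end Existence

section Constraints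

variable {X : Type*} [MeasurableSpace X]

lemma measurableSet_extBall (r : ℝ≥0) : MeasurableSet (extBall X r) :=
  measurableSet_le measurable_snd measurable_const

lemma homMarginal_apply (p : ℝ) (β : Measure (Ext X)) {A : Set X} (hA : MeasurableSet A) :
    homMarginal p β A = ∫⁻ y in Prod.fst ⁻¹' A, ((y.2 ^ p : ℝ≥0) : ℝ≥0∞) ∂β := by
  rw [homMarginal, Measure.map_apply measurable_fst hA, withDensity_apply _ (measurable_fst hA)]

lemma homMarginal_map_apply {Ω : Type*} [MeasurableSpace Ω] (p : ℝ) (α : Measure Ω)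
    {f : Ω → Ext X} (hf : Measurable f) {A : Set X} (hA : MeasurableSet A) :
    homMarginal p (α.map f) A =
      ∫⁻ ω in (fun ω => (f ω).1) ⁻¹' A, (((f ω).2 ^ p : ℝ≥0) : ℝ≥0∞) ∂α := by
  rw [homMarginal_apply p _ hA, setLIntegral_map (measurable_fst hA) (by fun_prop) hf]
  rfl

lemma homMarginal₀_eq (p : ℝ) (α : Measure (Ext X × Ext X)) :
    homMarginal₀ p α = homMarginal p (α.map Prod.fst) := by
  ext A hA
  rw [homMarginal_map_apply p α measurable_fst hA, homMarginal₀,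
    Measure.map_apply (by fun_prop) hA, withDensity_apply _ (hA.preimage (by fun_prop))]

lemma homMarginal₁_eq (p : ℝ) (α : Measure (Ext X × Ext X)) :
    homMarginal₁ p α = homMarginal p (α.map Prod.snd) := by
  ext A hA
  rw [homMarginal_map_apply p α measurable_snd hA, homMarginal₁,
    Measure.map_apply (by fun_prop) hA, withDensity_apply _ (hA.preimage (by fun_prop))]

lemma homMarginal_map_prodMk (p : ℝ) (r : ℝ≥0) (μ : Measure X) :
    homMarginal p (μ.map fun x => (x, r)) = (r ^ p : ℝ≥0) • μ := by
  ext A hA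
  rw [homMarginal_map_apply p μ (by fun_prop) hA]
  exact setLIntegral_const A ((r ^ p : ℝ≥0) : ℝ≥0∞)

lemma homMarginal_add (p : ℝ) (α β : Measure (Ext X)) :
    homMarginal p (α + β) = homMarginal p α + homMarginal p β := by
  ext A hA
  simp only [Measure.add_apply, homMarginal_apply p _ hA, Measure.restrict_add,
    lintegral_add_measure]

lemma homMarginal_smul (p : ℝ) (r : ℝ≥0) (α : Measure (Ext X)) :
    homMarginal p (r • α) = r • homMarginal p α := by
  ext A hA
  simp only [Measure.smul_apply, homMarginal_apply p _ hA, Measure.restrict_smul,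
    lintegral_smul_measure]

lemma homMarginal_apply_of_extBall {p : ℝ} {r : ℝ≥0} {β : Measure (Ext X)}
    (hβ : β (extBall X r)ᶜ = 0) {A : Set X} (hA : MeasurableSet A) :
    homMarginal p β A = ∫⁻ y in Prod.fst ⁻¹' A, ((min y.2 r ^ p : ℝ≥0) : ℝ≥0∞) ∂β := by
  rw [homMarginal_apply p _ hA]
  refine lintegral_congr_ae (ae_restrict_of_ae ?_)
  filter_upwards [mem_ae_iff.2 hβ] with y hy
  rw [min_eq_left (show y.2 ≤ r from hy)]

lemma tendsto_homMarginal_apply {ι : Type*} {l : Filter ι} {p : ℝ} (hp : 0 ≤ p) {r : ℝ≥0}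
    {α : ι → Measure (Ext X)} {β : Measure (Ext X)} (hα : ∀ i, α i (extBall X r)ᶜ = 0)
    (hβ : β (extBall X r)ᶜ = 0) (h : TendstoSetwise α l β) {A : Set X} (hA : MeasurableSet A) :
    Tendsto (fun i => homMarginal p (α i) A) l (𝓝 (homMarginal p β A)) := by
  simp only [homMarginal_apply_of_extBall (hα _) hA, homMarginal_apply_of_extBall hβ hA,
    ← lintegral_indicator (measurable_fst hA)]
  refine h _ (Measurable.indicator (by fun_prop) (measurable_fst hA))
    ⟨r ^ p, fun y => (Set.indicator_le_self _ _ y).trans (ENNReal.coe_le_coe.2 ?_)⟩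
  exact NNReal.rpow_le_rpow (min_le_right _ _) hp

lemma midpoint_mem_constraintSetOne {p : ℝ} {r : ℝ≥0} {μ : Measure X} {α β : Measure (Ext X)}
    (hα : α ∈ constraintSetOne p r μ) (hβ : β ∈ constraintSetOne p r μ) :
    (2⁻¹ : ℝ≥0) • (α + β) ∈ constraintSetOne p r μ := by
  obtain ⟨_, hαμ, hαr⟩ := hα
  obtain ⟨_, hβμ, hβr⟩ := hβ
  have htwo : (2⁻¹ : ℝ≥0) + 2⁻¹ = 1 := by norm_num
  refine ⟨⟨?_⟩, ?_, by simp [hαr, hβr]⟩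
  · rw [smul_add, Measure.add_apply, Measure.smul_apply, Measure.smul_apply, measure_univ,
      measure_univ, ← add_smul, htwo, one_smul]
  · rw [homMarginal_smul, homMarginal_add, hαμ, hβμ, smul_add, ← add_smul, htwo, one_smul]

lemma mem_constraintSetOne_of_tendstoSetwise {ι : Type*} {l : Filter ι} [l.NeBot] {p : ℝ}
    (hp : 0 ≤ p) {r : ℝ≥0} {μ : Measure X} {α : ι → Measure (Ext X)} {β : Measure (Ext X)}
    (hα : ∀ i, α i ∈ constraintSetOne p r μ) (h : TendstoSetwise α l β) :
    β ∈ constraintSetOne p r μ := by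
  have hprob (i : ι) : α i Set.univ = 1 := (hα i).1.measure_univ
  have hβ : β (extBall X r)ᶜ = 0 := tendsto_nhds_unique
    (by simpa only [(hα _).2.2] using h.apply (measurableSet_extBall r).compl) tendsto_const_nhds
  have huniv : β Set.univ = 1 := tendsto_nhds_unique
    (by simpa only [hprob] using h.apply .univ) tendsto_const_nhds
  refine ⟨⟨huniv⟩, ?_, hβ⟩
  ext A hA
  refine tendsto_nhds_unique (f := fun _ => μ A) (l := l) ?_ tendsto_const_nhds
  simpa only [(hα _).2.1] using tendsto_homMarginal_apply hp (fun i => (hα i).2.2) hβ h hA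

lemma mem_constraintSet_iff {p : ℝ} {μ₀ μ₁ : Measure X} {α : Measure (Ext X × Ext X)} :
    α ∈ constraintSet p μ₀ μ₁ ↔
      α.map Prod.fst ∈ constraintSetOne p (sStar p μ₀ μ₁) μ₀ ∧
      α.map Prod.snd ∈ constraintSetOne p (sStar p μ₀ μ₁) μ₁ := by
  have hB := (measurableSet_extBall (X := X) (sStar p μ₀ μ₁)).compl
  have hfst : IsProbabilityMeasure (α.map Prod.fst) ↔ IsProbabilityMeasure α :=
    Measure.isProbabilityMeasure_map_iff measurable_fst.aemeasurable
  have hsnd : IsProbabilityMeasure (α.map Prod.snd) ↔ IsProbabilityMeasure α :=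
    Measure.isProbabilityMeasure_map_iff measurable_snd.aemeasurable
  simp only [constraintSet, constraintSetOne, Set.mem_ofPred_eq, homMarginal₀_eq, homMarginal₁_eq,
    Measure.map_apply measurable_fst hB, Measure.map_apply measurable_snd hB, hfst, hsnd,
    Set.compl_prod_eq_union, measure_union_null_iff, ← Set.prod_univ, ← Set.univ_prod]
  tauto

lemma midpoint_mem_constraintSet {p : ℝ} {μ₀ μ₁ : Measure X} {α β : Measure (Ext X × Ext X)}
    (hα : α ∈ constraintSet p μ₀ μ₁) (hβ : β ∈ constraintSet p μ₀ μ₁) :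
    (2⁻¹ : ℝ≥0) • (α + β) ∈ constraintSet p μ₀ μ₁ := by
  rw [mem_constraintSet_iff] at hα hβ ⊢
  rw [Measure.map_smul, Measure.map_smul, Measure.map_add _ _ measurable_fst,
    Measure.map_add _ _ measurable_snd]
  exact ⟨midpoint_mem_constraintSetOne hα.1 hβ.1, midpoint_mem_constraintSetOne hα.2 hβ.2⟩

lemma mem_constraintSet_of_tendstoSetwise {ι : Type*} {l : Filter ι} [l.NeBot] {p : ℝ}
    (hp : 0 ≤ p) {μ₀ μ₁ : Measure X} {α : ι → Measure (Ext X × Ext X)}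
    {β : Measure (Ext X × Ext X)} (hα : ∀ i, α i ∈ constraintSet p μ₀ μ₁)
    (h : TendstoSetwise α l β) : β ∈ constraintSet p μ₀ μ₁ :=
  mem_constraintSet_iff.2
    ⟨mem_constraintSetOne_of_tendstoSetwise hp (fun i => (mem_constraintSet_iff.1 (hα i)).1)
      (h.map measurable_fst),
    mem_constraintSetOne_of_tendstoSetwise hp (fun i => (mem_constraintSet_iff.1 (hα i)).2)
      (h.map measurable_snd)⟩

lemma couplings_subset_constraintSet {p : ℝ} {μ₀ μ₁ : Measure X} {α : Measure (Ext X × Ext X)}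
    (hα : α ∈ constraintSet p μ₀ μ₁) :
    couplings (α.map Prod.fst) (α.map Prod.snd) ⊆ constraintSet p μ₀ μ₁ := by
  rintro β ⟨-, hfst, hsnd⟩
  rw [mem_constraintSet_iff] at hα ⊢
  rwa [hfst, hsnd]

lemma constraintSetOne_nonempty [Nonempty X] {p : ℝ} (hp : 0 < p) {r : ℝ≥0} {μ : Measure X}
    (hμ : μ Set.univ ≤ (r ^ p : ℝ≥0)) : (constraintSetOne p r μ).Nonempty := by
  obtain ⟨x⟩ := ‹Nonempty X›
  lift μ Set.univ to ℝ≥0 using (hμ.trans_lt ENNReal.coe_lt_top).ne with m hm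
  set w : ℝ≥0 := r ^ p
  have hmw : w⁻¹ * m ≤ 1 := inv_mul_le_one_of_le₀ (ENNReal.coe_le_coe.1 hμ) zero_le
  have hwμ : (w⁻¹ * w) • μ = μ := by
    rcases eq_or_ne w 0 with hw | hw
    · have : μ = 0 := Measure.measure_univ_eq_zero.1 (by simpa [hm, hw] using hμ)
      rw [this, smul_zero]
    · rw [inv_mul_cancel₀ hw, one_smul]
  -- The missing mass is put at height `0`, where the weight `s ^ p` vanishes.
  refine ⟨w⁻¹ • μ.map (fun x => (x, r)) + (1 - w⁻¹ * m) • (Measure.dirac x).map (fun x => (x, 0)),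
    ⟨?_⟩, ?_, ?_⟩
  · rw [Measure.add_apply, Measure.smul_apply, Measure.smul_apply,
      Measure.map_apply (by fun_prop) .univ, Measure.map_apply (by fun_prop) .univ,
      Set.preimage_univ, Set.preimage_univ, ← hm, measure_univ]
    simp only [ENNReal.smul_def, smul_eq_mul, mul_one]
    exact_mod_cast add_tsub_cancel_of_le hmw
  · rw [homMarginal_add, homMarginal_smul, homMarginal_smul, homMarginal_map_prodMk,
      homMarginal_map_prodMk, NNReal.zero_rpow hp.ne', zero_smul, smul_zero, add_zero, smul_smul,
      hwμ]
  · have hB := (measurableSet_extBall (X := X) r).compl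
    rw [Measure.add_apply, Measure.smul_apply, Measure.smul_apply,
      Measure.map_apply (by fun_prop) hB, Measure.map_apply (by fun_prop) hB]
    simp [extBall]

lemma coe_sStar_rpow {p : ℝ} (hp : p ≠ 0) (μ₀ μ₁ : Measure X) [IsFiniteMeasure μ₀]
    [IsFiniteMeasure μ₁] :
    ((sStar p μ₀ μ₁ ^ p : ℝ≥0) : ℝ≥0∞) = μ₀ Set.univ + μ₁ Set.univ := by
  rw [sStar, ← NNReal.rpow_mul, one_div_mul_cancel hp, NNReal.rpow_one, ENNReal.coe_add,
    ENNReal.coe_toNNReal (measure_ne_top _ _), ENNReal.coe_toNNReal (measure_ne_top _ _)]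

lemma constraintSet_nonempty [Nonempty X] {p : ℝ} (hp : 0 < p) (μ₀ μ₁ : Measure X)
    [IsFiniteMeasure μ₀] [IsFiniteMeasure μ₁] : (constraintSet p μ₀ μ₁).Nonempty := by
  have hsum := coe_sStar_rpow hp.ne' μ₀ μ₁
  obtain ⟨β₀, h₀⟩ := constraintSetOne_nonempty hp (le_self_add.trans_eq hsum.symm)
  obtain ⟨β₁, h₁⟩ := constraintSetOne_nonempty hp (le_add_self.trans_eq hsum.symm)
  have := h₀.1
  have := h₁.1
  refine ⟨β₀.prod β₁, mem_constraintSet_iff.2 ⟨?_, ?_⟩⟩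
  · simpa using h₀
  · simpa using h₁

end Constraints

end EUOT

theorem mainTheorem7_general {X : Type*} [MeasurableSpace X] [Nonempty X]
    (F : ℝ≥0 → ℝ≥0∞) (c : X × X → ℝ≥0∞) (p : ℝ) (hp : 0 < p)
    (μ₀ μ₁ : Measure X) [IsFiniteMeasure μ₀] [IsFiniteMeasure μ₁]
    (ν : Measure (EUOT.Ext X × EUOT.Ext X)) [IsFiniteMeasure ν] (ε : ℝ) (hε : 0 < ε) :
    ∃ α ∈ EUOT.constraintSet p μ₀ μ₁,
      EUOT.UOTY F c p ε ν μ₀ μ₁ = EUOT.energy F c p ε ν α ∧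
      EUOT.energy F c p ε ν α = EUOT.OTeps F c p ε ν (α.map Prod.fst) (α.map Prod.snd) ∧
      α.map Prod.fst ∈ EUOT.constraintSetOne p (EUOT.sStar p μ₀ μ₁) μ₀ ∧
      α.map Prod.snd ∈ EUOT.constraintSetOne p (EUOT.sStar p μ₀ μ₁) μ₁ := by
  obtain ⟨α, hα, hmin⟩ := EUOT.exists_isMinOn_entropicEnergy (ν := ν) (EUOT.Hp F c p)
    (Real.toNNReal_pos.2 hε) (EUOT.constraintSet_nonempty hp μ₀ μ₁) (fun _ h => h.1)
    (fun _ hα _ hβ => EUOT.midpoint_mem_constraintSet hα hβ)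
    (fun _ _ hα h => EUOT.mem_constraintSet_of_tendstoSetwise hp.le hα h)
  have hle : ∀ β ∈ EUOT.constraintSet p μ₀ μ₁,
      EUOT.energy F c p ε ν α ≤ EUOT.energy F c p ε ν β := fun _ hβ => hmin hβ
  refine ⟨α, hα, le_antisymm (iInf₂_le α hα) (le_iInf₂ hle), le_antisymm ?_ ?_,
    EUOT.mem_constraintSet_iff.1 hα⟩
  · exact le_iInf₂ fun β hβ => hle β (EUOT.couplings_subset_constraintSet hα hβ)
  · exact iInf₂_le α ⟨hα.1, rfl, rfl⟩

theorem mainTheorem7 {X : Type*} [MetricSpace X] [CompleteSpace X]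
    [TopologicalSpace.SeparableSpace X] [MeasurableSpace X] [BorelSpace X]
    (F : ℝ≥0 → ℝ≥0∞) (hF : EUOT.IsEntropyFunction F)
    (c : X × X → ℝ≥0∞) (hc : LowerSemicontinuous c)
    (p : ℝ) (hp : 0 < p)
    (μ₀ μ₁ : Measure X) [IsFiniteMeasure μ₀] [IsFiniteMeasure μ₁]
    (ν : Measure (EUOT.Ext X × EUOT.Ext X)) [IsProbabilityMeasure ν]
    (ε : ℝ) (hε : 0 < ε) :
    ∃ α ∈ EUOT.constraintSet p μ₀ μ₁,
      EUOT.UOTY F c p ε ν μ₀ μ₁ = EUOT.energy F c p ε ν α ∧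
      EUOT.energy F c p ε ν α = EUOT.OTeps F c p ε ν (α.map Prod.fst) (α.map Prod.snd) ∧
      α.map Prod.fst ∈ EUOT.constraintSetOne p (EUOT.sStar p μ₀ μ₁) μ₀ ∧
      α.map Prod.snd ∈ EUOT.constraintSetOne p (EUOT.sStar p μ₀ μ₁) μ₁ := by
  have : Nonempty X := (nonempty_of_isProbabilityMeasure ν).map fun y => y.1.1
  exact mainTheorem7_general F c p hp μ₀ μ₁ ν ε hε
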